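/- Let $k\ge 0$ and $q$ be integers. There is a constant $C=C(k,q)$, depending only on $k$ and $q$, such that the following holds for every finite field $\mathbb F$ with $|\mathbb F|=q$, every finite directed graph $G=(V,E)$ (parallel edges and loops allowed) and all pairs of nodes $(s_1,t_1),\dots,(s_k,t_k)$ of $G$. Give each $s_i$ an extra virtual incoming edge carrying an input $x_i\in\mathbb F$, and each $t_i$ an extra virtual outgoing edge. Suppose that the classical $k$-pair problem has a linear solution over $\mathbb F$, that is, for each node $v$ and each outgoing edge of $v$ there is an $\mathbb F$-linear function of the messages on the incoming edges of $v$, giving the message on that outgoing edge, such that these operations can be executed edge by edge (in some order of the edges, the message on each edge depends only on inputs at its tail and on messages on earlier edges; this is automatic if $G$ is acyclic) and such that, for all $x_1,\dots,x_k\in\mathbb F$, the message on the virtual outgoing edge for $t_i$ is $x_i$ for every $i$. Then the quantum $k$-pair problem on the same graph and pairs is solvable over $\mathcal H=\mathbb C^{|\mathbb F|}$ with at most $C$ elements of $\mathbb F$ of classical communication in total. That is, there is a finite protocol in which the nodes hold registers with state space $\mathcal H$ (all initially $|0\rangle$, except for $k$ input registers, the $i$-th owned by $s_i$), may apply unitaries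 to and make computational-basis measurements of registers that they own (the unitaries depending on the measurement outcomes and classical messages known to that node), may send at most one register along each edge of $G$, in the direction of the edge, and may send elements of $\mathbb F$ classically between any two nodes, at most $C$ elements in all, such that for every state $|\psi\rangle\in\mathcal H^{\otimes k}$ of the input registers and all measurement outcomes, $k$ output registers, the $i$-th owned by $t_i$, are finally in exactly the state $|\psi\rangle$, unentangled with the other registers. -/

import Mathlib

universe u v w

/-- An instance of the `k`-pair problem: a directed graph (parallel edges and loops are allowed) with
vertices `V` and edges `E`, the edge `e` going from `tail e` to `head e`, and `k` pairs
`(source i, target i)` of nodes. -/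
structure KPair (V : Type u) (E : Type v) (k : ℕ) where
  tail : E → V
  head : E → V
  source : Fin k → V
  target : Fin k → V

namespace KPair

/-! ### The classical problem -/

/-- The incoming edges of the node `a`: the edges of the graph that enter `a`, and one virtual edge
for each `i` with `source i = a`, carrying the `i`-th input. -/
abbrev In {V : Type u} {E : Type v} {k : ℕ} (N : KPair V E k) (a : V) : Type v :=
  {e : E // N.head e = a} ⊕ {i : Fin k // N.source i = a}

/-- The outgoing edges of the node `a`: the edges of the graph that leave `a`, and one virtual edge
for each `i` with `target i = a`, carrying the `i`-th output. -/
abbrev Out {V : Type u} {E : Type v} {k : ℕ} (N : KPair V E k) (a : V) : Type v :=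
  {e : E // N.tail e = a} ⊕ {i : Fin k // N.target i = a}

/-- A coding scheme over the alphabet `A`: for every node and every outgoing edge of it, a function
of the messages on the incoming edges of that node. -/
abbrev CodingScheme {V : Type u} {E : Type v} {k : ℕ} (N : KPair V E k) (A : Type w) :
    Type (max u v w) :=
  ∀ a : V, N.Out a → (N.In a → A) → A

/-- The messages that the node `a` receives when `x` is the tuple of inputs and `m e` is the message
on the edge `e`. -/
def received {V : Type u} {E : Type v} {k : ℕ} (N : KPair V E k) {A : Type w}
    (x : Fin k → A) (m : E → A) (a : V) : N.In a → A :=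
  Sum.elim (fun e => m e.1) (fun i => x i.1)

/-- The scheme can be executed edge by edge: in a suitable order of the edges, the message on an edge
is computed from the inputs at its tail and from the messages on earlier edges only. If the graph is
acyclic, this holds for every scheme (take a topological order). -/
def IsCausal {V : Type u} {E : Type v} {k : ℕ} (N : KPair V E k) {A : Type w}
    (f : N.CodingScheme A) : Prop :=
  ∃ rank : E → ℕ, ∀ (e : E) (z z' : N.In (N.tail e) → A),
    (∀ e' : {e' : E // N.head e' = N.tail e},
      rank e'.1 < rank e → z (Sum.inl e') = z' (Sum.inl e')) →
    (∀ i : {i : Fin k // N.source i = N.tail e}, z (Sum.inr i) = z' (Sum.inr i)) →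
    f (N.tail e) (Sum.inl ⟨e, rfl⟩) z = f (N.tail e) (Sum.inl ⟨e, rfl⟩) z'

/-- The scheme `f` is a solution: it can be executed, and on every tuple `x` of inputs the messages
`m` that it produces (which are unique by causality) make every target `i` output `x i`. -/
def IsSolution {V : Type u} {E : Type v} {k : ℕ} (N : KPair V E k) {A : Type w}
    (f : N.CodingScheme A) : Prop :=
  N.IsCausal f ∧ ∀ x : Fin k → A, ∃ m : E → A,
    (∀ e : E, m e = f (N.tail e) (Sum.inl ⟨e, rfl⟩) (N.received x m (N.tail e))) ∧
    ∀ i : Fin k,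
      f (N.target i) (Sum.inr ⟨i, rfl⟩) (N.received x m (N.target i)) = x i

/-- There is a linear solution over `R`: all the coding functions are `R`-linear. -/
def HasLinearSolution {V : Type u} {E : Type v} {k : ℕ} (N : KPair V E k) (R : Type w) [Ring R] :
    Prop :=
  ∃ f : N.CodingScheme R, (∀ (a : V) (o : N.Out a), IsLinearMap R (f a o)) ∧ N.IsSolution f

end KPair

/-! ### Quantum protocols with classical communication

Every register in `ρ` is a quantum system with Hilbert space `ℂ^A`, with orthonormal basis `|z⟩`,
`z : A`. A joint state of all registers is given by its amplitudes `(ρ → A) → ℂ`. Every node has a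
classical memory, a list of elements of `A`: the measurement outcomes obtained and the classical
messages received by that node, in order. -/

/-- The instructions of a protocol.
* `unitary a S U`: the node `a` applies the unitary `U l` to the registers in `S`, where `l` is the
  classical memory of `a`.
* `measure a r`: the node `a` measures the register `r` in the computational basis and stores the
  outcome.
* `sendQ e r`: the register `r` is sent along the edge `e` of the graph.
* `sendC a b g`: the node `a` sends the element `g l` of `A` to the node `b` as classical
  communication, where `l` is the classical memory of `a`. -/
inductive Instr (V : Type u) (E : Type u) (ρ : Type u) (A : Type w)
    [Fintype A] [DecidableEq A] [DecidableEq ρ] : Type (max u w) where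
  | unitary (a : V) (S : Finset ρ) (U : List A → Matrix.unitaryGroup (S → A) ℂ)
  | measure (a : V) (r : ρ)
  | sendQ (e : E) (r : ρ)
  | sendC (a b : V) (g : List A → A)

namespace Instr

/-- The registers in `S` are replaced by `y`, the others are kept as in `x`. -/
def override {ρ : Type u} {A : Type w} [DecidableEq ρ] (S : Finset ρ) (x : ρ → A) (y : S → A) :
    ρ → A :=
  fun r => if h : r ∈ S then y ⟨r, h⟩ else x r

/-- The operator `U ⊗ 1`, with `U` acting on the registers in `S`. -/
def applyOn {ρ : Type u} {A : Type w} [Fintype A] [DecidableEq ρ] (S : Finset ρ)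
    (U : Matrix (S → A) (S → A) ℂ) (Ψ : (ρ → A) → ℂ) : (ρ → A) → ℂ :=
  fun x => ∑ y : S → A, U (fun r => x r.1) y * Ψ (override S x y)

/-- The projection onto the states in which the register `r` is `|z⟩`. -/
def project {ρ : Type u} {A : Type w} [DecidableEq A] (r : ρ) (z : A) (Ψ : (ρ → A) → ℂ) :
    (ρ → A) → ℂ :=
  fun x => if x r = z then Ψ x else 0

/-- The owners of the registers after the instructions, `own` being the owners before. -/
def finalOwner {V E ρ : Type u} {k : ℕ} {A : Type w} [Fintype A] [DecidableEq A] [DecidableEq ρ]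
    (N : KPair V E k) : (ρ → V) → List (Instr V E ρ A) → ρ → V
  | own, [] => own
  | own, unitary _ _ _ :: l => finalOwner N own l
  | own, measure _ _ :: l => finalOwner N own l
  | own, sendQ e r :: l => finalOwner N (Function.update own r (N.head e)) l
  | own, sendC _ _ _ :: l => finalOwner N own l

/-- The instructions respect the network: a node operates only on registers that it owns, a register
is sent along an edge by the tail of this edge (which owns it) to its head, and every edge transmits
at most one register (`used` is the set of the edges already used). -/
def Legal {V E ρ : Type u} {k : ℕ} {A : Type w} [Fintype A] [DecidableEq A] [DecidableEq ρ]
    (N : KPair V E k) : (ρ → V) → Set E → List (Instr V E ρ A) → Prop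
  | _, _, [] => True
  | own, used, unitary a S _ :: l => (∀ r ∈ S, own r = a) ∧ Legal N own used l
  | own, used, measure a r :: l => own r = a ∧ Legal N own used l
  | own, used, sendQ e r :: l =>
      own r = N.tail e ∧ e ∉ used ∧
        Legal N (Function.update own r (N.head e)) (insert e used) l
  | own, used, sendC _ _ _ :: l => Legal N own used l

/-- The number of elements of `A` sent as classical communication. -/
def classicalCost {V E ρ : Type u} {A : Type w} [Fintype A] [DecidableEq A] [DecidableEq ρ] :
    List (Instr V E ρ A) → ℕ
  | [] => 0
  | sendC _ _ _ :: l => classicalCost l + 1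
  | unitary _ _ _ :: l => classicalCost l
  | measure _ _ :: l => classicalCost l
  | sendQ _ _ :: l => classicalCost l

/-- The set of the final states (one for each sequence of measurement outcomes, not normalized: the
square of the norm is the probability of that sequence of outcomes) when the instructions are
executed with the classical memories `mem` and the state `Ψ`. -/
def finalStates {V E ρ : Type u} {A : Type w} [Fintype A] [DecidableEq A] [DecidableEq ρ]
    [DecidableEq V] :
    List (Instr V E ρ A) → (V → List A) → ((ρ → A) → ℂ) → Set ((ρ → A) → ℂ)
  | [], _, Ψ => {Ψ}
  | unitary a S U :: l, mem, Ψ => finalStates l mem (applyOn S (U (mem a)).1 Ψ)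
  | measure a r :: l, mem, Ψ =>
      ⋃ z : A, finalStates l (Function.update mem a (mem a ++ [z])) (project r z Ψ)
  | sendQ _ _ :: l, mem, Ψ => finalStates l mem Ψ
  | sendC a b g :: l, mem, Ψ =>
      finalStates l (Function.update mem b (mem b ++ [g (mem a)])) Ψ

end Instr

/-- A protocol for the quantum `k`-pair problem over `ℂ^A`: a finite set of registers with their
initial owners, registers `S i` that hold the input and registers `T i` that hold the output, where
`S i` is initially owned by the `i`-th source and `T i` is finally owned by the `i`-th target, and a
list of instructions that respects the network. -/
structure QuantumProtocol {V E : Type u} {k : ℕ} (N : KPair V E k) (A : Type w)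
    [Fintype A] [DecidableEq A] where
  Reg : Type u
  [fintypeReg : Fintype Reg]
  [decEqReg : DecidableEq Reg]
  owner : Reg → V
  S : Fin k ↪ Reg
  T : Fin k ↪ Reg
  instrs : List (Instr V E Reg A)
  owner_S : ∀ i, owner (S i) = N.source i
  owner_T : ∀ i, Instr.finalOwner N owner instrs (T i) = N.target i
  legal : Instr.Legal N owner ∅ instrs

namespace QuantumProtocol

attribute [instance] QuantumProtocol.fintypeReg QuantumProtocol.decEqReg

open Classical in
/-- The initial state: the registers `S 0, …, S (k-1)` are in the state `ψ`, all the others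
in `|0⟩`. -/
noncomputable def initialState {V E : Type u} {k : ℕ} {N : KPair V E k} {A : Type w}
    [Fintype A] [DecidableEq A] [Zero A] (P : QuantumProtocol N A) (ψ : (Fin k → A) → ℂ) :
    (P.Reg → A) → ℂ :=
  fun x => if ∀ r, r ∉ Set.range P.S → x r = 0 then ψ (fun i => x (P.S i)) else 0

/-- The protocol solves the quantum `k`-pair problem: for every input state `ψ` and all measurement
outcomes, the registers `T 0, …, T (k-1)` are finally in the state `ψ`, in a tensor product
with some state `χ` of the other registers. (Normalization of `ψ` is immaterial, by linearity.) -/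
def Solves {V E : Type u} [DecidableEq V] {k : ℕ} {N : KPair V E k} {A : Type w}
    [Fintype A] [DecidableEq A] [Zero A] (P : QuantumProtocol N A) : Prop :=
  ∀ ψ : (Fin k → A) → ℂ,
    ∀ Ψ ∈ Instr.finalStates P.instrs (fun _ => []) (P.initialState ψ),
      ∃ χ : ({r : P.Reg // r ∉ Set.range P.T} → A) → ℂ,
        ∀ x : P.Reg → A, Ψ x = ψ (fun i => x (P.T i)) * χ (fun r => x r.1)

end QuantumProtocol

/-- The quantum `k`-pair problem is solvable over `ℂ^A` by a protocol that sends at most `c` elements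
of `A` as free classical communication. -/
def KPair.QuantumSolvable {V E : Type u} [DecidableEq V] {k : ℕ} (N : KPair V E k) (A : Type w)
    [Fintype A] [DecidableEq A] [Zero A] (c : ℕ) : Prop :=
  ∃ P : QuantumProtocol N A, P.Solves ∧ Instr.classicalCost P.instrs ≤ c

/-! ### A Ramsey theorem for pairs -/

/-! Executed coherently, a linear scheme puts one register per wire into a superposition, over the
inputs x, of the values of linear forms (labels) at x. Suppose y is the only input of a wire h. Then
the label of h is a nonzero multiple of that of y, and the two registers meet at one node, so that y
is reset to zero unitarily. Any other non-output register with nonzero label is measured in the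
Fourier basis. An outcome z leaves the phase ω(z · label(x)), a product of phases in the single x_i,
which the targets undo after receiving z: k classical elements per register. It remains to bound the
number of measured registers in terms of k and q.

For this the scheme is first replaced by a flow whose set of nonzero coefficients is minimal for the
given labels at the outputs (`IsMinimalFlow`); other labels may change. A measured wire is then an
input wire or feeds a join, meaning a wire with at least two inputs (`IsMinimalFlow.label_eq_zero`).
The inputs of a join have distinct labels (`IsMinimalFlow.eq_of_label_eq`), so there are at most q^k
of them. Everything thus rests on bounding the joins (`exists_join_bound`).

Among too many joins, Ramsey's theorem finds r = q(q-1) alike ones g_0 < g_1 < ...: some part of the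
inputs of each contributes the same vector λ, a unit injected at any of them has the same effect β
on the targets, and it changes the chosen part of every later one by the same γ ≠ 1. Delete all
these parts at once. The loss at g_j is then (1-γ)^j λ, so the targets lose β times the sum of the
(1-γ)^j, times λ. For this r the sum is 0 in F, and minimality is contradicted
(`IsMinimalFlow.no_uniform_chain`). -/

theorem exists_endHomogeneous (c m : ℕ) :
    ∃ n : ℕ, ∀ (C : Type w) [Fintype C] (α : Type u) [LinearOrder α] (col : α → α → C)
      (s : Finset α), Fintype.card C ≤ c → n ≤ s.card →
        ∃ t ⊆ s, t.card = m ∧ ∃ φ : α → C, ∀ i ∈ t, ∀ j ∈ t, i < j → col i j = φ i := by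
  classical
  induction m with
  | zero =>
    -- Size 1 rather than 0: an element of `s` is needed to produce some colour as a value of `φ`.
    refine ⟨1, fun C _ α _ col s _ hs => ⟨∅, by simp, rfl, ?_⟩⟩
    obtain ⟨a, -⟩ := Finset.card_pos.1 hs
    exact ⟨fun i => col i a, by simp⟩
  | succ m ih =>
    obtain ⟨n, hn⟩ := ih
    refine ⟨c * n + 2, fun C _ α _ col s hC hs => ?_⟩
    have hne : s.Nonempty := Finset.card_pos.1 (by omega)
    -- The least element becomes the first of the chain, and the rest is taken inside the most
    -- frequent colour class of pairs with `a`.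
    set a := s.min' hne with ha
    have has : a ∈ s := s.min'_mem hne
    have hcard : (s.erase a).card = s.card - 1 := Finset.card_erase_of_mem has
    have hlt : (Finset.univ : Finset C).card * n < (s.erase a).card := by
      rw [Finset.card_univ]
      have := Nat.mul_le_mul_right n hC
      omega
    obtain ⟨γ, -, hγ⟩ := Finset.exists_lt_card_fiber_of_mul_lt_card_of_maps_to
      (f := fun j => col a j) (fun j _ => Finset.mem_univ _) hlt
    obtain ⟨t, hts, htc, φ, hφ⟩ := hn C α col _ hC hγ.le
    have htm : ∀ j ∈ t, j ∈ s ∧ j ≠ a ∧ col a j = γ := fun j hj => by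
      have := hts hj
      simp only [Finset.mem_filter, Finset.mem_erase] at this
      exact ⟨this.1.2, this.1.1, this.2⟩
    have hat : a ∉ t := fun h => (htm a h).2.1 rfl
    refine ⟨insert a t, ?_, by rw [Finset.card_insert_of_notMem hat, htc],
      Function.update φ a γ, ?_⟩
    · intro j hj
      rcases Finset.mem_insert.1 hj with rfl | hj
      · exact has
      · exact (htm j hj).1
    · intro i hi j hj hij
      have hja : j ∈ t := by
        rcases Finset.mem_insert.1 hj with rfl | h
        · exfalso
          rcases Finset.mem_insert.1 hi with rfl | h'
          · exact lt_irrefl _ hij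
          · exact absurd (s.min'_le i (htm i h').1) (not_le.2 hij)
        · exact h
      rcases Finset.mem_insert.1 hi with rfl | h'
      · rw [Function.update_self]
        exact (htm j hja).2.2
      · rw [Function.update_of_ne (htm i h').2.1]
        exact hφ i h' j hja hij

theorem exists_homogeneous (c r : ℕ) :
    ∃ n : ℕ, ∀ (C : Type w) [Fintype C] (α : Type u) [LinearOrder α] (col : α → α → C)
      (s : Finset α), Fintype.card C ≤ c → n ≤ s.card →
        ∃ t ⊆ s, t.card = r ∧ ∃ γ : C, ∀ i ∈ t, ∀ j ∈ t, i < j → col i j = γ := by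
  classical
  obtain ⟨n, hn⟩ := exists_endHomogeneous.{u, w} c (c * r + 1)
  refine ⟨n, fun C _ α _ col s hC hs => ?_⟩
  obtain ⟨t, hts, htc, φ, hφ⟩ := hn C α col s hC hs
  have hlt : (Finset.univ : Finset C).card * r < t.card := by
    rw [Finset.card_univ, htc]
    have := Nat.mul_le_mul_right r hC
    omega
  obtain ⟨γ, -, hγ⟩ := Finset.exists_lt_card_fiber_of_mul_lt_card_of_maps_to
    (f := φ) (fun j _ => Finset.mem_univ _) hlt
  obtain ⟨t', ht', ht'c⟩ := Finset.exists_subset_card_eq hγ.le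
  have hm : ∀ j ∈ t', j ∈ t ∧ φ j = γ := fun j hj => by simpa using ht' hj
  exact ⟨t', fun j hj => hts (hm j hj).1, ht'c, γ, fun i hi j hj hij =>
    (hφ i (hm i hi).1 j (hm j hj).1 hij).trans (hm i hi).2⟩

/-! ### Linear flows -/

section Flow

variable {X : Type u} [Fintype X] {F : Type w} [Field F] {k : ℕ}

/-- The labels `ℓ` are produced by the transition coefficients `M` from the inputs `b`. -/
def IsFlow (b : X → Fin k → F) (M : X → X → F) (ℓ : X → Fin k → F) : Prop :=
  ∀ x, ℓ x = ∑ y, M x y • ℓ y + b x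

/-- A flow such that no flow with the same labels at the targets has a smaller set of nonzero
coefficients. -/
def IsMinimalFlow (b : X → Fin k → F) (t : Fin k → X) (M : X → X → F) (ℓ : X → Fin k → F) : Prop :=
  IsFlow b M ℓ ∧ ∀ M' ℓ', IsFlow b M' ℓ' → (∀ i, ℓ' (t i) = ℓ (t i)) →
    (∀ x y, M' x y ≠ 0 → M x y ≠ 0) → ∀ x y, M x y ≠ 0 → M' x y ≠ 0

theorem IsFlow.exists_minimal {b : X → Fin k → F} (t : Fin k → X) {M : X → X → F}
    {ℓ : X → Fin k → F} (h : IsFlow b M ℓ) :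
    ∃ M' ℓ', IsMinimalFlow b t M' ℓ' ∧ (∀ i, ℓ' (t i) = ℓ (t i)) ∧
      ∀ x y, M' x y ≠ 0 → M x y ≠ 0 := by
  induction hn : Set.ncard {p : X × X | M p.1 p.2 ≠ 0} using Nat.strong_induction_on
    generalizing M ℓ with
  | _ n ih =>
    by_cases hmin : IsMinimalFlow b t M ℓ
    · exact ⟨M, ℓ, hmin, fun _ => rfl, fun _ _ h => h⟩
    · simp only [IsMinimalFlow, not_and, not_forall] at hmin
      obtain ⟨M', ℓ', hf, ht, hs, x, y, hxy, hxy'⟩ := hmin h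
      have hlt : Set.ncard {p : X × X | M' p.1 p.2 ≠ 0} < n := by
        rw [← hn]
        refine Set.ncard_lt_ncard ⟨fun p hp => hs _ _ hp, fun hsub => ?_⟩ (Set.toFinite _)
        exact hxy' (hsub (show (x, y) ∈ {p : X × X | M p.1 p.2 ≠ 0} from hxy))
      obtain ⟨M'', ℓ'', hm, ht', hs'⟩ := ih _ hlt hf rfl
      exact ⟨M'', ℓ'', hm, fun i => (ht' i).trans (ht i), fun x y h => hs _ _ (hs' _ _ h)⟩

/-- Otherwise the coefficient of `y'` could be shifted onto `y`, which changes no label and frees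
one coefficient. -/
theorem IsMinimalFlow.eq_of_label_eq {b : X → Fin k → F} {t : Fin k → X} {M : X → X → F}
    {ℓ : X → Fin k → F} (h : IsMinimalFlow b t M ℓ) {x y y' : X} (hy : M x y ≠ 0)
    (hy' : M x y' ≠ 0) (hℓ : ℓ y = ℓ y') : y = y' := by
  classical
  by_contra hne
  let M' : X → X → F := fun x' z => M x' z +
    if x' = x then (if z = y then M x y' else 0) - (if z = y' then M x y' else 0) else 0
  have hM' : M' x y' = 0 := by simp [M', Ne.symm hne]
  refine h.2 M' ℓ (fun x' => ?_) (fun _ => rfl) (fun x' z hz => ?_) x y' hy' hM'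
  · rw [h.1 x']
    congr 1
    by_cases hx : x' = x
    · simp [M', hx, add_smul, sub_smul, Finset.sum_add_distrib, Finset.sum_sub_distrib, hℓ]
    · simp [M', hx]
  · intro h0
    apply hz
    by_cases hx : x' = x
    · subst hx
      have h1 : z ≠ y := fun h => hy (h ▸ h0)
      have h2 : z ≠ y' := fun h => hy' (h ▸ h0)
      simp [M', h1, h2, h0]
    · simp [M', hx, h0]

/-- Nothing reads `y`, so its whole row can be deleted; by minimality the row was already zero. -/
theorem IsMinimalFlow.label_eq_zero {b : X → Fin k → F} {t : Fin k → X} {M : X → X → F}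
    {ℓ : X → Fin k → F} (h : IsMinimalFlow b t M ℓ) {y : X} (hb : b y = 0) (ht : ∀ i, t i ≠ y)
    (hy : ∀ x, M x y = 0) : ℓ y = 0 := by
  classical
  have key : ∀ z, M y z = 0 := by
    intro z
    by_contra hz
    refine h.2 (fun x z => if x = y then 0 else M x z) (Function.update ℓ y 0) (fun x => ?_)
      (fun i => Function.update_of_ne (ht i) _ _) (fun x z hxz => ?_) y z hz (by simp)
    · by_cases hx : x = y
      · simp [hx, hb]
      · rw [Function.update_of_ne hx, h.1 x]
        congr 1
        refine Finset.sum_congr rfl fun z _ => ?_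
        by_cases hzy : z = y
        · simp [hzy, hy]
        · simp [hx, hzy]
    · by_cases hx : x = y
      · simp [hx] at hxz
      · simpa [hx] using hxz
  rw [h.1 y]
  simp [key, hb]

/-- The response of all vertices to a unit input at the vertex `g`. -/
theorem exists_response {M : X → X → F} {rank : X → ℕ}
    (hM : ∀ x y, M x y ≠ 0 → rank y < rank x) [DecidableEq X] (g : X) :
    ∃ v : X → F, (∀ x, v x = ∑ y, M x y * v y + if x = g then 1 else 0) ∧
      ∀ x, rank x ≤ rank g → x ≠ g → v x = 0 := by
  -- `M` is strictly triangular with respect to `rank`, so 1 - M is invertible.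
  have hinj : Function.Injective ((1 - Matrix.of M : Matrix X X F).mulVecLin) := by
    rw [← LinearMap.ker_eq_bot, LinearMap.ker_eq_bot']
    intro v hv
    have hv' : ∀ x, v x = ∑ y, M x y * v y := fun x => by
      have := congrFun hv x
      simpa [Matrix.sub_mulVec, Matrix.mulVec, dotProduct, sub_eq_zero] using this
    have : ∀ n x, rank x = n → v x = 0 := by
      intro n
      induction n using Nat.strong_induction_on with
      | _ n ih =>
        intro x hx
        rw [hv' x]
        refine Finset.sum_eq_zero fun y _ => ?_
        by_cases h : M x y = 0
        · simp [h]
        · rw [ih (rank y) (hx ▸ hM x y h) y rfl, mul_zero]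
    exact funext fun x => this _ x rfl
  obtain ⟨v, hv⟩ := (LinearMap.injective_iff_surjective.1 hinj) (Pi.single g 1)
  have hv' : ∀ x, v x = ∑ y, M x y * v y + if x = g then 1 else 0 := fun x => by
    have := congrFun hv x
    rw [Matrix.mulVecLin_apply, Matrix.sub_mulVec, Matrix.one_mulVec, Pi.sub_apply,
      Pi.single_apply] at this
    rw [← this]
    exact (add_sub_cancel _ _).symm
  refine ⟨v, hv', ?_⟩
  have : ∀ n x, rank x = n → rank x ≤ rank g → x ≠ g → v x = 0 := by
    intro n
    induction n using Nat.strong_induction_on with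
    | _ n ih =>
      intro x hx hle hne
      rw [hv' x, if_neg hne, add_zero]
      refine Finset.sum_eq_zero fun y _ => ?_
      by_cases h : M x y = 0
      · simp [h]
      · have hlt := hM x y h
        rw [ih (rank y) (hx ▸ hlt) y rfl (hlt.le.trans hle)
          (fun h => by subst h; omega), mul_zero]
  exact fun x => this _ x rfl

theorem sum_one_sub_pow_mul (γ : F) (n : ℕ) :
    (∑ i ∈ Finset.range n, (1 - γ) ^ i) * γ = 1 - (1 - γ) ^ n := by
  have := geom_sum_mul_neg (1 - γ) n
  rwa [sub_sub_cancel] at this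

/-- The factor q serves γ = 0, where all terms are 1; the factor q - 1 serves the other γ, where the
power of 1 - γ closing the geometric sum is 1. For γ = 1 the sum would be 1. -/
theorem sum_one_sub_pow_eq_zero [Fintype F] {γ : F} (hγ : γ ≠ 1) :
    ∑ i ∈ Finset.range (Fintype.card F * (Fintype.card F - 1)), (1 - γ) ^ i = 0 := by
  by_cases h0 : γ = 0
  · simp [h0]
  · have h := sum_one_sub_pow_mul γ (Fintype.card F * (Fintype.card F - 1))
    rw [mul_comm (Fintype.card F) _, pow_mul,
      FiniteField.pow_card_sub_one_eq_one _ (sub_ne_zero.2 hγ.symm), one_pow, sub_self] at h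
    rw [mul_comm (Fintype.card F) _]
    exact (mul_eq_zero.1 h).resolve_right h0

/-- In a minimal flow there is no long chain of uniform removable partial rows `u j` of vertices
`g j`, unless the transfer `γ` from each of them to the later ones is `1`. -/
theorem IsMinimalFlow.no_uniform_chain [Fintype F] {b : X → Fin k → F} {t : Fin k → X}
    {M : X → X → F} {ℓ : X → Fin k → F} (h : IsMinimalFlow b t M ℓ) [DecidableEq X]
    {r : ℕ} (hr : r = Fintype.card F * (Fintype.card F - 1))
    {g : Fin r → X} (hg : Function.Injective g) {u v : Fin r → X → F}
    (hu : ∀ j y, u j y ≠ 0 → u j y = M (g j) y) {lam β : Fin k → F} {γ : F} (hγ : γ ≠ 1)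
    (hlam : ∀ j, ∑ y, u j y • ℓ y = lam)
    (hv : ∀ i x, v i x = ∑ y, M x y * v i y + if x = g i then 1 else 0)
    (hβ : ∀ i m, v i (t m) = β m)
    (huv : ∀ i j, ∑ y, u j y * v i y = if i < j then γ else 0) (j : Fin r) (y : X) :
    u j y = 0 := by
  by_contra hne
  have hgj : ∀ (x : X) (f : Fin r → F) (j : Fin r), x = g j →
      ∑ i, (if x = g i then f i else 0) = f j := by
    rintro x f j rfl
    simp [hg.eq_iff]
  -- All partial rows are deleted simultaneously; `ℓ'` subtracts the responses to the resulting
  -- losses, (1-γ)^i λ at `g i`.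
  let M' : X → X → F := fun x y => M x y - ∑ j, if x = g j then u j y else 0
  let ℓ' : X → Fin k → F := fun x => ℓ x - (∑ i : Fin r, (1 - γ) ^ (i : ℕ) * v i x) • lam
  have hMj : ∀ j y, M' (g j) y = M (g j) y - u j y := fun j y => by
    simp only [M']
    rw [hgj _ (fun j => u j y) j rfl]
  -- Consistency of these losses: what the deleted row would carry under the new labels is λ minus γ
  -- times the earlier losses, a telescoping geometric sum.
  have hu' : ∀ j, ∑ y, u j y • ℓ' y = (1 - γ) ^ (j : ℕ) • lam := by
    intro j
    have h1 : ∑ y, u j y * (∑ i : Fin r, (1 - γ) ^ (i : ℕ) * v i y) = 1 - (1 - γ) ^ (j : ℕ) := by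
      calc ∑ y, u j y * (∑ i : Fin r, (1 - γ) ^ (i : ℕ) * v i y)
          = ∑ i : Fin r, (1 - γ) ^ (i : ℕ) * ∑ y, u j y * v i y := by
            simp only [Finset.mul_sum]
            rw [Finset.sum_comm]
            exact Finset.sum_congr rfl fun i _ => Finset.sum_congr rfl fun y _ => by ring
        _ = ∑ i : Fin r, if (i : ℕ) < j then (1 - γ) ^ (i : ℕ) * γ else 0 := by
            refine Finset.sum_congr rfl fun i _ => ?_
            rw [huv]
            simp only [Fin.lt_def, mul_ite, mul_zero]
        _ = ∑ i ∈ Finset.range r, if i < (j : ℕ) then (1 - γ) ^ i * γ else 0 :=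
            Fin.sum_univ_eq_sum_range (fun i => if i < (j : ℕ) then (1 - γ) ^ i * γ else 0) r
        _ = ∑ i ∈ Finset.range j, (1 - γ) ^ i * γ := by
            rw [← Finset.sum_filter]
            refine Finset.sum_congr ?_ fun _ _ => rfl
            ext i
            have := j.2
            simp only [Finset.mem_filter, Finset.mem_range]
            omega
        _ = _ := by rw [← Finset.sum_mul, sum_one_sub_pow_mul]
    simp only [ℓ', smul_sub, Finset.sum_sub_distrib, hlam, smul_smul]
    rw [← Finset.sum_smul, h1, sub_smul, one_smul, sub_sub_cancel]
  have hMℓ : ∀ x, ∑ y, M x y • ℓ' y + b x =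
      ℓ' x + (∑ i : Fin r, if x = g i then (1 - γ) ^ (i : ℕ) else 0) • lam := by
    intro x
    have h2 : ∑ y, M x y * (∑ i : Fin r, (1 - γ) ^ (i : ℕ) * v i y) =
        ∑ i : Fin r, (1 - γ) ^ (i : ℕ) * v i x -
          ∑ i : Fin r, (if x = g i then (1 - γ) ^ (i : ℕ) else 0) := by
      rw [← Finset.sum_sub_distrib]
      simp only [Finset.mul_sum]
      rw [Finset.sum_comm]
      refine Finset.sum_congr rfl fun i _ => ?_
      rw [hv i x, mul_add, Finset.mul_sum, mul_ite, mul_one, mul_zero, add_sub_cancel_right]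
      exact Finset.sum_congr rfl fun y _ => by ring
    simp only [ℓ', smul_sub, Finset.sum_sub_distrib, smul_smul]
    rw [← Finset.sum_smul, h2, h.1 x, sub_smul]
    abel
  refine h.2 M' ℓ' (fun x => ?_) (fun m => ?_) (fun x z hz h0 => ?_) (g j) y ?_ ?_
  · have h3 : ∑ y, M' x y • ℓ' y = ∑ y, M x y • ℓ' y -
        (∑ i : Fin r, if x = g i then (1 - γ) ^ (i : ℕ) else 0) • lam := by
      simp only [M', sub_smul, Finset.sum_sub_distrib]
      congr 1
      by_cases hx : ∃ j, x = g j
      · obtain ⟨j, hj⟩ := hx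
        rw [hgj x _ j hj, ← hu' j]
        refine Finset.sum_congr rfl fun y _ => ?_
        rw [hgj x (fun j => u j y) j hj]
      · push Not at hx
        simp [hx]
    rw [h3, sub_add_eq_add_sub, hMℓ, add_sub_cancel_right]
  -- The targets do not notice: the common response β factors out of a vanishing geometric sum.
  · have : ∑ i : Fin r, (1 - γ) ^ (i : ℕ) * v i (t m) = 0 := by
      simp only [hβ]
      rw [← Finset.sum_mul, Fin.sum_univ_eq_sum_range (fun i => (1 - γ) ^ i) r, hr,
        sum_one_sub_pow_eq_zero hγ, zero_mul]
    simp [ℓ', this]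
  · by_cases hx : ∃ j, x = g j
    · obtain ⟨j, rfl⟩ := hx
      rw [hMj] at hz
      by_cases huz : u j z = 0
      · exact hz (by rw [huz, h0, sub_zero])
      · exact hz (by rw [hu j z huz, sub_self])
    · push Not at hx
      exact hz (by simp [M', hx, h0])
  · rw [← hu j y hne]
    exact hne
  · rw [hMj, hu j y hne, sub_self]

/-- The form used after Ramsey: the partial row is the restriction of the row of `g j` to `D (g j)`,
and only transfers to later vertices are prescribed. The others vanish, since the inputs of `g j`
have smaller rank than every `g i` with i ≥ j. -/
theorem IsMinimalFlow.coeff_eq_zero_of_uniform_chain [Fintype F] {b : X → Fin k → F} {t : Fin k → X}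
    {M : X → X → F} {ℓ : X → Fin k → F} (h : IsMinimalFlow b t M ℓ) {rank : X → ℕ}
    (hM : ∀ x y, M x y ≠ 0 → rank y < rank x) [DecidableEq X] {v : X → X → F}
    (hv : ∀ g x, v g x = ∑ y, M x y * v g y + if x = g then 1 else 0)
    (hv0 : ∀ g x, rank x ≤ rank g → x ≠ g → v g x = 0)
    {r : ℕ} (hr : r = Fintype.card F * (Fintype.card F - 1))
    {g : Fin r → X} (hg : Function.Injective g) (hrank : ∀ i j, i ≤ j → rank (g i) ≤ rank (g j))
    (D : X → Finset X) {β lam : Fin k → F} {γ : F} (hγ : γ ≠ 1)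
    (hβ : ∀ i m, v (g i) (t m) = β m) (hlam : ∀ j, ∑ y ∈ D (g j), M (g j) y • ℓ y = lam)
    (huv : ∀ i j, i < j → ∑ y ∈ D (g j), M (g j) y * v (g i) y = γ)
    (j : Fin r) (y : X) (hy : y ∈ D (g j)) : M (g j) y = 0 := by
  have key := h.no_uniform_chain hr hg (u := fun j y => if y ∈ D (g j) then M (g j) y else 0)
    (v := fun i => v (g i)) (lam := lam) (β := β) (fun j y hne => ?_) hγ (fun j => ?_)
    (fun i x => hv (g i) x) hβ (fun i j => ?_) j y
  · simpa [hy] using key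
  · by_contra hy
    simp only [ite_eq_left_iff, not_forall] at hy
    simp [hy.1] at hne
  · rw [← hlam j]
    simp [ite_smul, Finset.sum_ite_mem]
  · simp only [ite_mul, zero_mul, Finset.sum_ite_mem, Finset.univ_inter]
    split_ifs with hij
    · exact huv i j hij
    · refine Finset.sum_eq_zero fun y _ => ?_
      by_cases h0 : M (g j) y = 0
      · simp [h0]
      · have hlt := (hM _ _ h0).trans_le (hrank j i (not_lt.1 hij))
        rw [hv0 _ _ hlt.le (fun h => by simp [h] at hlt), mul_zero]

end Flow

/-! ### Counting joins and unabsorbed vertices -/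

theorem exists_linearOrder_monotone {X : Type u} [Fintype X] (rank : X → ℕ) :
    ∃ _ : LinearOrder X, ∀ x y : X, x ≤ y → rank x ≤ rank y := by
  refine ⟨LinearOrder.lift' (fun x => toLex (rank x, Fintype.equivFin X x)) (fun x y hxy => by
    simpa using congrArg (fun z => (ofLex z).2) hxy), fun x y hxy => ?_⟩
  have h : toLex (rank x, Fintype.equivFin X x) ≤ toLex (rank y, Fintype.equivFin X y) := hxy
  rw [Prod.Lex.toLex_le_toLex] at h
  rcases h with h | h
  · exact h.le
  · exact h.1.le

/-- The number of vertices of a minimal flow with at least two nonzero incoming coefficients is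
bounded in terms of `k` and the size of the field. -/
theorem exists_join_bound (k q : ℕ) :
    ∃ J : ℕ, ∀ (F : Type w) [Field F] [Fintype F], Fintype.card F = q →
      ∀ (X : Type u) [Fintype X] (b : X → Fin k → F) (t : Fin k → X) (M : X → X → F)
        (ℓ : X → Fin k → F) (rank : X → ℕ), IsMinimalFlow b t M ℓ →
        (∀ x y, M x y ≠ 0 → rank y < rank x) →
        ∀ s : Finset X, (∀ x ∈ s, ∃ y z, z ≠ y ∧ M x y ≠ 0 ∧ M x z ≠ 0) → s.card ≤ J := by
  classical
  obtain ⟨n, hn⟩ := exists_homogeneous.{u, w} (q * q) (q * (q - 1))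
  -- The factor before `n` counts the vertex colours: two contributions and one response at the
  -- targets, each a vector in F^k. Pairs of vertices are coloured by two transfers, whence q * q
  -- colours in `hn`.
  refine ⟨q ^ k * (q ^ k * q ^ k) * n, fun F _ _ hq X _ b t M ℓ rank hmin hM s hs => ?_⟩
  by_contra! hlt
  obtain ⟨_, hmono⟩ := exists_linearOrder_monotone rank
  choose! p₁ p₂ hp hp₁ hp₂ using hs
  choose v hv hv0 using exists_response hM
  let vc : X → (Fin k → F) × (Fin k → F) × (Fin k → F) := fun x =>
    (M x (p₁ x) • ℓ (p₁ x), M x (p₂ x) • ℓ (p₂ x), fun m => v x (t m))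
  obtain ⟨⟨lam₁, lam₂, β⟩, -, hfib⟩ := Finset.exists_lt_card_fiber_of_mul_lt_card_of_maps_to
    (s := s) (t := Finset.univ) (n := n) (f := vc) (fun x _ => Finset.mem_univ _)
    (by simpa [Finset.card_univ, hq] using hlt)
  obtain ⟨T, hTs, hTc, ⟨γ₁, γ₂⟩, hT⟩ := hn (F × F) X
    (fun x y => (M y (p₁ y) * v x (p₁ y), M y (p₂ y) * v x (p₂ y))) _ (by simp [hq]) hfib.le
  let g := T.orderEmbOfFin hTc
  have hgT : ∀ j, g j ∈ T := fun j => T.orderEmbOfFin_mem hTc j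
  have hgs : ∀ j, g j ∈ s := fun j => (Finset.mem_filter.1 (hTs (hgT j))).1
  have hgv : ∀ j, vc (g j) = (lam₁, lam₂, β) := fun j => (Finset.mem_filter.1 (hTs (hgT j))).2
  have hgl₁ : ∀ j, M (g j) (p₁ (g j)) • ℓ (p₁ (g j)) = lam₁ := fun j => congrArg (·.1) (hgv j)
  have hgl₂ : ∀ j, M (g j) (p₂ (g j)) • ℓ (p₂ (g j)) = lam₂ := fun j => congrArg (·.2.1) (hgv j)
  have hgβ : ∀ j m, v (g j) (t m) = β m := fun j m => congrFun (congrArg (·.2.2) (hgv j)) m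
  have hgγ : ∀ i j, i < j → M (g j) (p₁ (g j)) * v (g i) (p₁ (g j)) = γ₁ ∧
      M (g j) (p₂ (g j)) * v (g i) (p₂ (g j)) = γ₂ := fun i j hij => by
    have := hT _ (hgT i) _ (hgT j) (g.strictMono hij)
    exact ⟨congrArg (·.1) this, congrArg (·.2) this⟩
  have hrpos : 0 < q * (q - 1) := by
    have : 1 < q := hq ▸ Fintype.one_lt_card
    exact Nat.mul_pos (by omega) (by omega)
  have hr : q * (q - 1) = Fintype.card F * (Fintype.card F - 1) := by rw [hq]
  have key := fun (D : X → Finset X) (lam : Fin k → F) (γ : F) (hγ : γ ≠ 1) =>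
    hmin.coeff_eq_zero_of_uniform_chain (lam := lam) (γ := γ) hM hv hv0 hr g.injective (fun i j hij => hmono _ _ (g.monotone hij)) D hγ hgβ
  have h₁ := hp₁ _ (hgs ⟨0, hrpos⟩)
  have h₂ := hp₂ _ (hgs ⟨0, hrpos⟩)
  have hne := fun j => (hp _ (hgs j)).symm
  -- Why two inputs are needed: one of γ₁, γ₂ and γ₁ + γ₂ differs from 1, so deleting one of the
  -- inputs or both is admissible.
  by_cases hγ₁ : γ₁ = 1
  · by_cases hγ₂ : γ₂ = 1
    · refine h₁ (key (fun x => {p₁ x, p₂ x}) (lam₁ + lam₂) (γ₁ + γ₂) ?_ (fun j => ?_)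
        (fun i j hij => ?_) ⟨0, hrpos⟩ _ (by simp))
      · simp [hγ₁, hγ₂]
      · rw [Finset.sum_pair (hne j), hgl₁, hgl₂]
      · rw [Finset.sum_pair (hne j), (hgγ i j hij).1, (hgγ i j hij).2]
    · refine h₂ (key (fun x => {p₂ x}) lam₂ γ₂ hγ₂ (fun j => ?_) (fun i j hij => ?_)
        ⟨0, hrpos⟩ _ (by simp))
      · rw [Finset.sum_singleton, hgl₂]
      · rw [Finset.sum_singleton, (hgγ i j hij).2]
  · refine h₁ (key (fun x => {p₁ x}) lam₁ γ₁ hγ₁ (fun j => ?_) (fun i j hij => ?_)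
      ⟨0, hrpos⟩ _ (by simp))
    · rw [Finset.sum_singleton, hgl₁]
    · rw [Finset.sum_singleton, (hgγ i j hij).1]

/-- In a minimal flow, the number of vertices with nonzero label that are not the only input of some
vertex is bounded in terms of `k` and the size of the field. -/
theorem exists_unabsorbed_bound (k q : ℕ) :
    ∃ B : ℕ, ∀ (F : Type w) [Field F] [Fintype F], Fintype.card F = q →
      ∀ (X : Type u) [Fintype X] (b : X → Fin k → F) (src t : Fin k → X) (M : X → X → F)
        (ℓ : X → Fin k → F) (rank : X → ℕ), IsMinimalFlow b t M ℓ →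
        (∀ x y, M x y ≠ 0 → rank y < rank x) → (∀ y, (∀ i, src i ≠ y) → b y = 0) →
        ∀ s : Finset X, (∀ y ∈ s, ℓ y ≠ 0 ∧ (∀ i, t i ≠ y) ∧
          ∀ x, M x y ≠ 0 → ∃ z, z ≠ y ∧ M x z ≠ 0) → s.card ≤ B := by
  classical
  obtain ⟨J, hJ⟩ := exists_join_bound.{u, w} k q
  refine ⟨k + J * q ^ k, fun F _ _ hq X _ b src t M ℓ rank hmin hM hb s hs => ?_⟩
  let joins : Finset X := Finset.univ.filter fun x => ∃ y z, z ≠ y ∧ M x y ≠ 0 ∧ M x z ≠ 0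
  -- An unabsorbed vertex that is no source must be read by some vertex, since its label is nonzero,
  -- and that vertex is a join.
  have hsub : s ⊆ Finset.univ.image src ∪
      joins.biUnion fun x => Finset.univ.filter fun y => M x y ≠ 0 := by
    intro y hy
    obtain ⟨hℓ, ht, hx⟩ := hs y hy
    simp only [Finset.mem_union, Finset.mem_image, Finset.mem_univ, true_and, Finset.mem_biUnion,
      Finset.mem_filter, joins]
    by_contra hcon
    push Not at hcon
    refine hℓ (hmin.label_eq_zero (hb y hcon.1) ht fun x => ?_)
    by_contra hxy
    obtain ⟨z, hz, hxz⟩ := hx x hxy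
    exact hxy (hcon.2 x ⟨y, z, hz, hxy, hxz⟩)
  refine (Finset.card_le_card hsub).trans ((Finset.card_union_le _ _).trans (add_le_add ?_ ?_))
  · exact Finset.card_image_le.trans (by simp)
  · refine (Finset.card_biUnion_le_card_mul _ _ (q ^ k) fun x _ => ?_).trans
      (Nat.mul_le_mul_right _ (hJ F hq X b t M ℓ rank hmin hM joins fun x hx => by
        simpa [joins] using hx))
    rw [show q ^ k = (Finset.univ : Finset (Fin k → F)).card by simp [hq]]
    refine Finset.card_le_card_of_injOn ℓ (fun _ _ => Finset.mem_coe.2 (Finset.mem_univ _)) ?_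
    intro y hy z hz hyz
    simp only [Finset.coe_filter, Finset.mem_univ, true_and, Set.mem_ofPred_eq] at hy hz
    exact hmin.eq_of_label_eq hy hz hyz

/-! ### Unitaries -/

namespace Instr

section Unitary

variable {ρ : Type u} [DecidableEq ρ] {A : Type w} [Fintype A] [DecidableEq A]

/-- The unitary that permutes the basis states. -/
def permUnitary {B : Type v} [Fintype B] [DecidableEq B] (σ : Equiv.Perm B) :
    Matrix.unitaryGroup B ℂ :=
  ⟨Matrix.of fun i j => if σ i = j then 1 else 0, by
    rw [Matrix.mem_unitaryGroup_iff]
    ext i j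
    simp [Matrix.mul_apply, Matrix.star_apply, Matrix.one_apply, eq_comm]⟩

theorem applyOn_permUnitary (S : Finset ρ) (σ : Equiv.Perm (S → A)) (Ψ : (ρ → A) → ℂ) (x : ρ → A) :
    applyOn S (permUnitary σ).1 Ψ x = Ψ (override S x (σ fun r => x r.1)) := by
  simp [applyOn, permUnitary]

/-- The unitary on a single register given by `W`. -/
def singleUnitary (r : ρ) (W : Matrix.unitaryGroup A ℂ) :
    Matrix.unitaryGroup (({r} : Finset ρ) → A) ℂ :=
  ⟨Matrix.of fun y z => W.1 (y ⟨r, by simp⟩) (z ⟨r, by simp⟩), by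
    rw [Matrix.mem_unitaryGroup_iff]
    have h := Matrix.mem_unitaryGroup_iff.1 W.2
    ext y z
    have h' := congrFun (congrFun h (y ⟨r, by simp⟩)) (z ⟨r, by simp⟩)
    rw [Matrix.mul_apply] at h' ⊢
    rw [← (Equiv.funUnique ({r} : Finset ρ) A).sum_comp] at h'
    refine Eq.trans ?_ (h'.trans ?_)
    · rfl
    · rw [Matrix.one_apply, Matrix.one_apply]
      congr 1
      rw [eq_iff_iff]
      refine ⟨fun h => funext fun ⟨s, hs⟩ => ?_, fun h => by rw [h]⟩
      obtain rfl := Finset.mem_singleton.1 hs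
      exact h⟩

theorem applyOn_singleUnitary (r : ρ) (W : Matrix.unitaryGroup A ℂ) (Ψ : (ρ → A) → ℂ) (x : ρ → A) :
    applyOn {r} (singleUnitary r W).1 Ψ x = ∑ a, W.1 (x r) a * Ψ (Function.update x r a) := by
  rw [← (Equiv.funUnique ({r} : Finset ρ) A).sum_comp]
  refine Finset.sum_congr rfl fun y _ => ?_
  congr 2
  ext s
  by_cases h : s = r
  · subst h
    simp only [override, Finset.mem_singleton, dite_true, Function.update_self]
    rfl
  · simp [override, h]

end Unitary

section Field

variable {F : Type w} [Field F] [Fintype F] [DecidableEq F]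

/-- The Fourier transform of the additive group of a finite field. -/
noncomputable def fourier (F : Type w) [Field F] [Fintype F] [DecidableEq F] :
    Matrix.unitaryGroup F ℂ :=
  ⟨Matrix.of fun a b => ((Real.sqrt (Fintype.card F))⁻¹ : ℝ) *
      AddChar.FiniteField.primitiveChar_to_Complex F (a * b), by
    rw [Matrix.mem_unitaryGroup_iff]
    ext a b
    have h := AddChar.sum_mulShift (a - b)
      (AddChar.FiniteField.primitiveChar_to_Complex_isPrimitive F)
    have hq : (Fintype.card F : ℝ) ≠ 0 := by exact_mod_cast Fintype.card_ne_zero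
    have hs : (((Real.sqrt (Fintype.card F))⁻¹ : ℝ) : ℂ) * (((Real.sqrt (Fintype.card F))⁻¹ : ℝ) : ℂ)
        = ((Fintype.card F : ℝ) : ℂ)⁻¹ := by
      rw [← Complex.ofReal_mul, ← mul_inv, Real.mul_self_sqrt (by positivity), Complex.ofReal_inv]
    rw [Matrix.mul_apply]
    simp only [Matrix.star_apply, Matrix.of_apply, star_mul', RCLike.star_def, Complex.conj_ofReal,
      ← AddChar.map_neg_eq_conj]
    calc _ = ∑ c : F, ((Fintype.card F : ℝ) : ℂ)⁻¹ *
          AddChar.FiniteField.primitiveChar_to_Complex F (c * (a - b)) := by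
          refine Finset.sum_congr rfl fun c _ => ?_
          rw [mul_mul_mul_comm, hs, ← AddChar.map_add_eq_mul]
          ring_nf
      _ = _ := by
          rw [← Finset.mul_sum, h, Matrix.one_apply]
          by_cases hab : a = b
          · simp [hab]
          · simp [hab, sub_eq_zero]⟩

/-- The phase `|a⟩ ↦ ω(c a)|a⟩`. -/
noncomputable def phase (c : F) : Matrix.unitaryGroup F ℂ :=
  ⟨Matrix.diagonal fun a => AddChar.FiniteField.primitiveChar_to_Complex F (c * a), by
    rw [Matrix.mem_unitaryGroup_iff, Matrix.star_eq_conjTranspose, Matrix.diagonal_conjTranspose,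
      Matrix.diagonal_mul_diagonal, ← Matrix.diagonal_one]
    congr 1
    ext a
    simp only [Pi.star_apply, RCLike.star_def, ← AddChar.map_neg_eq_conj,
      ← AddChar.map_add_eq_mul, add_neg_cancel, AddChar.map_zero_eq_one]⟩

theorem applyOn_phase {ρ : Type u} [DecidableEq ρ] (r : ρ) (c : F) (Ψ : (ρ → F) → ℂ) (x : ρ → F) :
    applyOn {r} (singleUnitary r (phase c)).1 Ψ x =
      AddChar.FiniteField.primitiveChar_to_Complex F (c * x r) * Ψ x := by
  rw [applyOn_singleUnitary, Finset.sum_eq_single (x r)]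
  · simp [phase]
  · intro a _ ha
    simp [phase, Matrix.diagonal_apply_ne' _ ha]
  · simp

/-- The map `z ↦ z` with `z h` replaced by `z h - c * z y`. -/
def shear {B : Type v} [DecidableEq B] {h y : B} (hy : y ≠ h) (c : F) : Equiv.Perm (B → F) where
  toFun z := Function.update z h (z h - c * z y)
  invFun z := Function.update z h (z h + c * z y)
  left_inv z := by simp [Function.update_of_ne hy]
  right_inv z := by simp [Function.update_of_ne hy]

theorem applyOn_shear {ρ : Type u} [DecidableEq ρ] {h y : ρ} (hy : y ≠ h) (c : F)
    (Ψ : (ρ → F) → ℂ) (x : ρ → F) :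
    applyOn {h, y} (permUnitary (shear (B := ({h, y} : Finset ρ)) (h := ⟨h, by simp⟩)
      (y := ⟨y, by simp⟩) (by simpa using hy) c)).1 Ψ x =
        Ψ (Function.update x h (x h - c * x y)) := by
  rw [applyOn_permUnitary]
  congr 1
  ext s
  by_cases hs : s = h
  · subst hs
    simp [override, shear]
  · by_cases hs' : s = y
    · subst hs'
      simp [override, shear, hs]
    · simp [override, hs, hs']

end Field

/-! ### Linear states -/

section Linear

variable {V E ρ : Type u} [DecidableEq V] [Fintype ρ] [DecidableEq ρ] {k : ℕ}
  {F : Type w} [Field F] [Fintype F] [DecidableEq F]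

open Classical in
/-- The superposition of the basis states in which each register `r` holds the value of the linear
form `lab r` at `x`, with amplitudes `ψ x`. -/
noncomputable def labelState (lab : ρ → Fin k → F) (ψ : (Fin k → F) → ℂ) : (ρ → F) → ℂ :=
  fun y => ∑ x, if ∀ r, y r = lab r ⬝ᵥ x then ψ x else 0

/-- There are instructions without measurements and classical communication that change the owners,
the used edges and the labels of a linear state as indicated. -/
def Reach (N : KPair V E k) (own : ρ → V) (used : Set E) (lab : ρ → Fin k → F)
    (own' : ρ → V) (used' : Set E) (lab' : ρ → Fin k → F) : Prop :=
  ∃ l : List (Instr V E ρ F), ∀ l' : List (Instr V E ρ F),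
    (Legal N own' used' l' → Legal N own used (l ++ l')) ∧
    finalOwner N own (l ++ l') = finalOwner N own' l' ∧
    classicalCost (l ++ l') = classicalCost l' ∧
    ∀ ψ mem, finalStates (l ++ l') mem (labelState lab ψ) = finalStates l' mem (labelState lab' ψ)

variable {N : KPair V E k} {own own' own'' : ρ → V} {used used' used'' : Set E}
  {lab lab' lab'' : ρ → Fin k → F}

theorem Reach.refl : Reach N own used lab own used lab :=
  ⟨[], fun _ => ⟨id, rfl, rfl, fun _ _ => rfl⟩⟩

theorem Reach.of_eq (ho : own = own') (hu : used = used') (hl : lab = lab') :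
    Reach N own used lab own' used' lab' := by
  subst ho hu hl
  exact Reach.refl

/-- Composition is concatenation: the arbitrary continuation `l'` in `Reach` takes the place of
separate statements about appended programs. -/
theorem Reach.trans (h : Reach N own used lab own' used' lab')
    (h' : Reach N own' used' lab' own'' used'' lab'') : Reach N own used lab own'' used'' lab'' := by
  obtain ⟨l₁, h₁⟩ := h
  obtain ⟨l₂, h₂⟩ := h'
  refine ⟨l₁ ++ l₂, fun l' => ?_⟩
  rw [List.append_assoc]
  obtain ⟨a, b, c, d⟩ := h₁ (l₂ ++ l')
  obtain ⟨a', b', c', d'⟩ := h₂ l'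
  exact ⟨a ∘ a', b.trans b', c.trans c', fun ψ mem => (d ψ mem).trans (d' ψ mem)⟩

theorem Reach.send {e : E} {r : ρ} (hr : own r = N.tail e) (he : e ∉ used) :
    Reach N own used lab (Function.update own r (N.head e)) (insert e used) lab :=
  ⟨[sendQ e r], fun _ => ⟨fun h => ⟨hr, he, h⟩, rfl, rfl, fun _ _ => rfl⟩⟩

/-- Amplitudes are pulled back along the permutation, so the subtraction in `shear` becomes an
addition of labels. -/
theorem Reach.add {h y : ρ} (hy : y ≠ h) (ho : own h = own y) (c : F) :
    Reach N own used lab own used (Function.update lab h (lab h + c • lab y)) := by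
  refine ⟨[unitary (own y) {h, y} fun _ => permUnitary (shear (B := ({h, y} : Finset ρ))
    (h := ⟨h, by simp⟩) (y := ⟨y, by simp⟩) (by simpa using hy) c)],
    fun l' => ⟨fun hl => ⟨?_, hl⟩, rfl, rfl, fun ψ mem => ?_⟩⟩
  · intro r hr
    rcases Finset.mem_insert.1 hr with rfl | hr
    · exact ho
    · rw [Finset.mem_singleton.1 hr]
  · simp only [List.singleton_append, finalStates]
    congr 1
    ext z
    rw [applyOn_shear hy]
    refine Finset.sum_congr rfl fun x _ => if_congr ?_ rfl rfl
    constructor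
    · intro H r
      by_cases hr : r = h
      · subst hr
        have h1 := H r
        have h2 := H y
        rw [Function.update_of_ne hy] at h2
        rw [Function.update_self] at h1 ⊢
        rw [add_dotProduct, smul_dotProduct, ← h1, ← h2, smul_eq_mul, sub_add_cancel]
      · have h1 := H r
        rw [Function.update_of_ne hr] at h1 ⊢
        exact h1
    · intro H r
      by_cases hr : r = h
      · subst hr
        have h1 := H r
        have h2 := H y
        rw [Function.update_of_ne hy] at h2
        rw [Function.update_self] at h1 ⊢
        rw [h1, h2, add_dotProduct, smul_dotProduct, smul_eq_mul, add_sub_cancel_right]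
      · have h1 := H r
        rw [Function.update_of_ne hr] at h1 ⊢
        exact h1

theorem Reach.add_many {y : ρ} (S : Finset ρ) (hy : y ∉ S) (ho : ∀ h ∈ S, own h = own y)
    (c : ρ → F) :
    Reach N own used lab own used (fun h => if h ∈ S then lab h + c h • lab y else lab h) := by
  induction S using Finset.induction_on with
  | empty => simpa using Reach.refl
  | insert a S ha ih =>
    have hya : y ≠ a := fun h => hy (h ▸ Finset.mem_insert_self _ _)
    have hyS : y ∉ S := fun h => hy (Finset.mem_insert_of_mem h)
    refine (ih hyS fun h hh => ho h (Finset.mem_insert_of_mem hh)).trans ?_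
    have := Reach.add (N := N) (used := used)
      (lab := fun h => if h ∈ S then lab h + c h • lab y else lab h) hya
      (ho a (Finset.mem_insert_self _ _)) (c a)
    convert this using 1
    ext1 h
    by_cases hh : h = a
    · subst hh
      simp [ha, hyS]
    · simp [hh]

end Linear

end Instr

/-! ### Wires -/

namespace KPair

/-- The edges of the graph, the virtual edges that carry the inputs, and those that carry the
outputs. -/
abbrev Wire (E : Type u) (k : ℕ) : Type u := E ⊕ (Fin k ⊕ Fin k)

/-- The `i`-th input wire. -/
def inputWire {E : Type u} {k : ℕ} : Fin k ↪ Wire E k :=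
  ⟨fun i => Sum.inr (Sum.inl i), fun _ _ h => Sum.inl_injective (Sum.inr_injective h)⟩

/-- The `i`-th output wire. -/
def outputWire {E : Type u} {k : ℕ} : Fin k ↪ Wire E k :=
  ⟨fun i => Sum.inr (Sum.inr i), fun _ _ h => Sum.inr_injective (Sum.inr_injective h)⟩

section Wire

variable {V E : Type u} {k : ℕ} (N : KPair V E k)

/-- The node at which a wire starts. -/
def wireTail : Wire E k → V
  | Sum.inl e => N.tail e
  | Sum.inr (Sum.inl i) => N.source i
  | Sum.inr (Sum.inr i) => N.target i

/-- The node at which a wire ends. -/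
def wireHead : Wire E k → V
  | Sum.inl e => N.head e
  | Sum.inr (Sum.inl i) => N.source i
  | Sum.inr (Sum.inr i) => N.target i

/-- Input wires come before the edges, and output wires after them. -/
def wireRank [Fintype E] (rank : E → ℕ) : Wire E k → ℕ
  | Sum.inl e => rank e + 1
  | Sum.inr (Sum.inl _) => 0
  | Sum.inr (Sum.inr _) => Finset.univ.sup rank + 2

/-- The input of the network at the wires. -/
def wireInput (F : Type w) [Field F] : Wire E k → Fin k → F
  | Sum.inr (Sum.inl i) => Pi.single i 1
  | _ => 0

/-- The wire of an incoming edge of a node. -/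
def inWire {a : V} : N.In a → Wire E k
  | Sum.inl e => Sum.inl e.1
  | Sum.inr i => Sum.inr (Sum.inl i.1)

theorem wireHead_inWire {a : V} (p : N.In a) : N.wireHead (N.inWire p) = a := by
  rcases p with ⟨e, he⟩ | ⟨i, hi⟩
  · exact he
  · exact hi

/-- The coding function for a wire. -/
def wireCoding {F : Type w} [Field F] (f : N.CodingScheme F) :
    ∀ x : Wire E k, (N.In (N.wireTail x) → F) → F
  | Sum.inl e => f (N.tail e) (Sum.inl ⟨e, rfl⟩)
  | Sum.inr (Sum.inl _) => 0
  | Sum.inr (Sum.inr i) => f (N.target i) (Sum.inr ⟨i, rfl⟩)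

theorem isLinearMap_wireCoding {F : Type w} [Field F] {f : N.CodingScheme F}
    (hf : ∀ (a : V) (o : N.Out a), IsLinearMap F (f a o)) (x : Wire E k) :
    IsLinearMap F (N.wireCoding f x) := by
  rcases x with e | i | i
  · exact hf _ _
  · exact ⟨fun _ _ => (add_zero _).symm, fun _ _ => (mul_zero _).symm⟩
  · exact hf _ _

open Classical in
/-- A linear solution gives a flow on the wires. -/
theorem HasLinearSolution.exists_flow [Fintype E] {N : KPair V E k} {F : Type w} [Field F]
    (h : N.HasLinearSolution F) :
    ∃ (rank : E → ℕ) (M : Wire E k → Wire E k → F) (ℓ : Wire E k → Fin k → F),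
      IsFlow (wireInput F) M ℓ ∧ (∀ i, ℓ (outputWire i) = Pi.single i 1) ∧
      ∀ x y, M x y ≠ 0 → wireRank rank y < wireRank rank x ∧ N.wireHead y = N.wireTail x := by
  obtain ⟨f, hf, ⟨rank, hrank⟩, hsol⟩ := h
  choose m hm hout using fun j : Fin k => hsol (Pi.single j 1)
  have hlin := N.isLinearMap_wireCoding hf
  -- By linearity the runs on unit inputs determine the labels: the j-th coordinate is the message
  -- in the j-th run.
  let ℓ : Wire E k → Fin k → F := Sum.elim (fun e j => m j e)
    (Sum.elim (fun i => Pi.single i 1) (fun i => Pi.single i 1))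
  have hrec : ∀ (a : V) (j : Fin k), N.received (Pi.single j 1) (m j) a =
      fun p => ℓ (N.inWire p) j := by
    intro a j
    ext p
    rcases p with e | i
    · rfl
    · simp [received, inWire, ℓ, Pi.single_apply, eq_comm]
  refine ⟨rank, fun x y => ∑ p : N.In (N.wireTail x),
    if N.inWire p = y then N.wireCoding f x (Pi.single p 1) else 0, ℓ, ?_, fun _ => rfl, ?_⟩
  · intro x
    ext j
    have h1 : (∑ y, (∑ p : N.In (N.wireTail x),
        if N.inWire p = y then N.wireCoding f x (Pi.single p 1) else 0) • ℓ y) j =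
        N.wireCoding f x (fun p => ℓ (N.inWire p) j) := by
      have h2 := (hlin x).mk'.pi_apply_eq_sum_univ (fun p => ℓ (N.inWire p) j)
      simp only [IsLinearMap.mk'_apply] at h2
      rw [h2]
      simp only [Finset.sum_apply, Pi.smul_apply, smul_eq_mul, Finset.sum_mul]
      rw [Finset.sum_comm]
      refine Finset.sum_congr rfl fun p _ => ?_
      simp only [ite_mul, zero_mul, Finset.sum_ite_eq, Finset.mem_univ, if_true]
      rw [mul_comm]
      congr 2
      ext q
      simp [Pi.single_apply, eq_comm]
    rw [Pi.add_apply, h1]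
    rcases x with e | i | i
    · have := hm j e
      rw [hrec] at this
      exact this.trans (add_zero _).symm
    · simp [wireInput, wireCoding, ℓ]
    · have := hout j i
      rw [hrec] at this
      simp only [wireInput, wireCoding, Pi.zero_apply, add_zero, wireTail]
      rw [this]
      simp [ℓ, Pi.single_apply, eq_comm]
  · intro x y hxy
    obtain ⟨p, -, hp⟩ := Finset.exists_ne_zero_of_sum_ne_zero hxy
    simp only [ne_eq, ite_eq_right_iff, Classical.not_imp] at hp
    obtain ⟨rfl, hp⟩ := hp
    refine ⟨?_, N.wireHead_inWire p⟩
    rcases x with e | i | i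
    · rcases p with e' | i
      · simp only [inWire, wireRank, add_lt_add_iff_right]
        by_contra hlt
        -- By causality an edge that is not earlier cannot influence `e`, so its coefficient equals
        -- the value at 0.
        refine hp ((hrank e (Pi.single (Sum.inl e') 1) 0 (fun e'' he'' => ?_) (fun i => ?_)).trans
          (hlin (Sum.inl e)).map_zero)
        · have : (Sum.inl e'' : N.In (N.tail e)) ≠ Sum.inl e' := fun h =>
            hlt (Sum.inl_injective h ▸ he'')
          exact Pi.single_eq_of_ne this _
        · simp
      · simp [inWire, wireRank]
    · exact absurd rfl hp
    · rcases p with e' | i'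
      · have := Finset.le_sup (f := rank) (Finset.mem_univ e'.1)
        simp only [inWire, wireRank]
        omega
      · simp [inWire, wireRank]

end Wire

end KPair

/-! ### The coherent part of the protocol -/

namespace Instr

open KPair

section Coherent

/-- The vertex `y` is the only input of some vertex. -/
def Absorbed {X : Type u} {F : Type w} [Field F] (M : X → X → F) (y : X) : Prop :=
  ∃ h, M h y ≠ 0 ∧ ∀ z, z ≠ y → M h z = 0

variable {V E : Type u} [DecidableEq V] [Fintype E] [DecidableEq E] {k : ℕ} {N : KPair V E k}
  {F : Type w} [Field F] [Fintype F] [DecidableEq F]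

open Classical in
/-- The labels when the wires in `A` have been processed. -/
noncomputable def partialLabel (M : Wire E k → Wire E k → F) (ℓ : Wire E k → Fin k → F)
    (A : Finset (Wire E k)) (z : Wire E k) : Fin k → F :=
  if z ∈ A then (if Absorbed M z then 0 else ℓ z) else ∑ y ∈ A, M z y • ℓ y + wireInput F z

/-- The owners when the wires in `A` have been processed. -/
def partialOwner (N : KPair V E k) (A : Finset (Wire E k)) (z : Wire E k) : V :=
  if z ∈ A then N.wireHead z else N.wireTail z

/-- Only edges of the graph need sending; a virtual wire starts and ends at the same node. -/
theorem Reach.transmit {A : Finset (Wire E k)} {y : Wire E k} (hy : y ∉ A)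
    (lab : Wire E k → Fin k → F) :
    Reach N (partialOwner N A) {e | Sum.inl e ∈ A} lab
      (partialOwner N (insert y A)) {e | Sum.inl e ∈ insert y A} lab := by
  rcases y with e | y
  · have := Reach.send (N := N) (own := partialOwner N A) (used := {e | Sum.inl e ∈ A})
      (lab := lab) (e := e) (r := Sum.inl e) (by simp [partialOwner, hy, wireTail]) hy
    convert this using 1
    · ext z
      by_cases hz : z = Sum.inl e
      · subst hz
        simp [partialOwner, wireHead]
      · simp [partialOwner, hz]
    · ext e'
      simp
  · have h1 : partialOwner N (insert (Sum.inr y) A) = partialOwner N A := by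
      ext z
      rcases z with e | i | i <;> simp [partialOwner, wireHead, wireTail]
    have h2 : {e | Sum.inl e ∈ insert (Sum.inr y) A} = {e : E | (Sum.inl e : Wire E k) ∈ A} := by
      ext e
      simp
    rw [h1, h2]
    exact Reach.refl

/-- All inputs of `y` have been processed, so its register already carries `ℓ y`. It is moved to its
head and added into the wires that read it; these are unprocessed and hence still wait at that node.
If some of them reads nothing else, it serves to erase `y`. -/
theorem Reach.process {rank : E → ℕ} {M : Wire E k → Wire E k → F} {ℓ : Wire E k → Fin k → F}
    (hflow : IsFlow (wireInput F) M ℓ)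
    (hM : ∀ x y, M x y ≠ 0 → wireRank rank y < wireRank rank x ∧ N.wireHead y = N.wireTail x)
    {A : Finset (Wire E k)} {y : Wire E k} (hy : y ∉ A)
    (hlow : ∀ z, wireRank rank z < wireRank rank y → z ∈ A)
    (hhigh : ∀ z ∈ A, wireRank rank z ≤ wireRank rank y) :
    Reach N (partialOwner N A) {e | Sum.inl e ∈ A} (partialLabel M ℓ A)
      (partialOwner N (insert y A)) {e | Sum.inl e ∈ insert y A} (partialLabel M ℓ (insert y A)) := by
  classical
  have hMA : ∀ h ∈ insert y A, M h y = 0 := by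
    intro h hh
    by_contra hne
    have hlt := (hM _ _ hne).1
    rcases Finset.mem_insert.1 hh with rfl | hh
    · exact lt_irrefl _ hlt
    · exact absurd hlt (hhigh h hh).not_gt
  have hlabel : partialLabel M ℓ A y = ℓ y := by
    rw [partialLabel, if_neg hy, hflow y]
    congr 1
    refine Finset.sum_subset (Finset.subset_univ A) fun z _ hz => ?_
    have : M y z = 0 := by
      by_contra hne
      exact hz (hlow z (hM _ _ hne).1)
    rw [this, zero_smul]
  have hown : ∀ h, M h y ≠ 0 →
      partialOwner N (insert y A) h = partialOwner N (insert y A) y := by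
    intro h hh
    have hhA : h ∉ insert y A := fun hm => hh (hMA h hm)
    rw [partialOwner, partialOwner, if_neg hhA, if_pos (Finset.mem_insert_self _ _)]
    exact (hM _ _ hh).2.symm
  -- The labels just before the erasure of `y`.
  let lab₁ : Wire E k → Fin k → F := fun h => if h = y then ℓ y else partialLabel M ℓ (insert y A) h
  have hlab₁ : (fun h => if h ∈ Finset.univ.filter (fun h => M h y ≠ 0) then
      partialLabel M ℓ A h + M h y • partialLabel M ℓ A y else partialLabel M ℓ A h) = lab₁ := by
    ext1 h
    simp only [Finset.mem_filter, Finset.mem_univ, true_and, lab₁, hlabel]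
    by_cases hh : h ∈ insert y A
    · rw [if_neg (not_not.2 (hMA h hh))]
      rcases Finset.mem_insert.1 hh with rfl | hhA
      · rw [if_pos rfl, hlabel]
      · rw [if_neg (fun he : h = y => hy (he ▸ hhA)), partialLabel, partialLabel, if_pos hhA, if_pos hh]
    · have hhA : h ∉ A := fun hm => hh (Finset.mem_insert_of_mem hm)
      have hhy : h ≠ y := fun he => hh (he ▸ Finset.mem_insert_self _ _)
      rw [if_neg hhy, partialLabel, partialLabel, if_neg hhA, if_neg hh, Finset.sum_insert hy]
      split_ifs with h0
      · abel
      · rw [not_not.1 h0, zero_smul, zero_add]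
  refine (Reach.transmit hy _).trans (Reach.trans (Reach.add_many (y := y)
    (Finset.univ.filter fun h => M h y ≠ 0)
    (by simpa using hMA y (Finset.mem_insert_self _ _))
    (fun h hh => hown h (by simpa using hh)) (fun h => M h y)) ?_)
  rw [hlab₁]
  by_cases hab : Absorbed M y
  · obtain ⟨h, hhy, hhz⟩ := id hab
    have hhA : h ∉ insert y A := fun hm => hhy (hMA h hm)
    have hne : h ≠ y := fun he => hhA (he ▸ Finset.mem_insert_self _ _)
    have hl : lab₁ h = M h y • ℓ y := by
      -- An input wire has rank 0 and reads nothing, so `h` is not one.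
      have hb : wireInput F h = 0 := by
        rcases h with e | i | i
        · rfl
        · exact absurd (hM _ _ hhy).1 (Nat.not_lt_zero _)
        · rfl
      simp only [lab₁]
      rw [if_neg hne, partialLabel, if_neg hhA, hb, add_zero, Finset.sum_insert hy,
        Finset.sum_eq_zero, add_zero]
      intro z hz
      rw [hhz z (fun he => hy (he ▸ hz)), zero_smul]
    have := Reach.add (N := N) (used := {e | Sum.inl e ∈ insert y A}) (lab := lab₁) hne
      (hown h hhy).symm (-(M h y)⁻¹)
    convert this using 1
    ext1 z
    by_cases hz : z = y
    · subst hz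
      rw [Function.update_self, hl, smul_smul, neg_mul, inv_mul_cancel₀ hhy]
      simp [partialLabel, hab, lab₁]
    · rw [Function.update_of_ne hz]
      simp only [lab₁]
      rw [if_neg hz]
  · refine Reach.of_eq rfl rfl ?_
    ext1 z
    by_cases hz : z = y
    · subst hz
      simp [partialLabel, hab, lab₁]
    · simp only [lab₁]
      rw [if_neg hz]

-- Induction over sets of wires closed under passing to smaller rank, the last processed wire being
-- one of maximal rank.
open Classical in
theorem Reach.all {rank : E → ℕ} {M : Wire E k → Wire E k → F} {ℓ : Wire E k → Fin k → F}
    (hflow : IsFlow (wireInput F) M ℓ)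
    (hM : ∀ x y, M x y ≠ 0 → wireRank rank y < wireRank rank x ∧ N.wireHead y = N.wireTail x) :
    Reach N N.wireTail ∅ (wireInput F) N.wireHead Set.univ
      (fun z => if Absorbed M z then 0 else ℓ z) := by
  have key : ∀ A : Finset (Wire E k),
      (∀ z ∈ A, ∀ z', wireRank rank z' < wireRank rank z → z' ∈ A) →
      Reach N N.wireTail ∅ (wireInput F) (partialOwner N A) {e | Sum.inl e ∈ A}
        (partialLabel M ℓ A) := by
    intro A
    induction A using Finset.strongInduction with
    | H A ih =>
      intro hA
      rcases A.eq_empty_or_nonempty with rfl | hne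
      · refine Reach.of_eq ?_ ?_ ?_
        · ext z
          simp [partialOwner]
        · ext e
          simp
        · ext1 z
          simp [partialLabel]
      · obtain ⟨y, hyA, hy⟩ := A.exists_max_image (wireRank rank) hne
        have hstep := Reach.process (N := N) hflow hM (A := A.erase y) (y := y)
          (Finset.notMem_erase y A)
          (fun z hz => Finset.mem_erase.2 ⟨fun h => by simp [h] at hz, hA y hyA z hz⟩)
          (fun z hz => hy z (Finset.mem_of_mem_erase hz))
        rw [Finset.insert_erase hyA] at hstep
        refine (ih _ (Finset.erase_ssubset hyA) fun z hz z' hz' => ?_).trans hstep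
        refine Finset.mem_erase.2 ⟨fun h => ?_, hA z (Finset.mem_of_mem_erase hz) z' hz'⟩
        subst h
        exact absurd hz' (hy z (Finset.mem_of_mem_erase hz)).not_gt
  have := key Finset.univ (fun _ _ _ _ => Finset.mem_univ _)
  convert this using 1
  · ext z
    simp [partialOwner]
  · ext e
    simp
  · ext1 z
    simp [partialLabel]

end Coherent

end Instr

/-! ### Measuring the remaining registers -/

namespace Instr

open KPair

section Measure

variable {V E ρ : Type u} [DecidableEq ρ] {k : ℕ} {F : Type w} [Field F] [DecidableEq F]

open Classical in
/-- The registers `T i` hold the state `ψ`, the registers in `L` the values of the linear forms `lab`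
at it, and the remaining registers are unentangled with these. -/
def IsResidual [Fintype ρ] (T : Fin k ↪ ρ) (lab : ρ → Fin k → F) (ψ : (Fin k → F) → ℂ) (L : Finset ρ)
    (Ψ : (ρ → F) → ℂ) : Prop :=
  ∃ χ : (ρ → F) → ℂ,
    (∀ x x' : ρ → F, (∀ r, r ∉ L → r ∉ Set.range T → x r = x' r) → χ x = χ x') ∧
    ∀ y, Ψ y = if ∀ r ∈ L, y r = lab r ⬝ᵥ (fun i => y (T i)) then
      ψ (fun i => y (T i)) * χ y else 0

-- The registers `T i` carry the coordinate forms, so they determine x and only one term of the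
-- superposition survives.
open Classical in
theorem isResidual_labelState [Fintype ρ] [Fintype F] {T : Fin k ↪ ρ} {lab : ρ → Fin k → F}
    (hT : ∀ i, lab (T i) = Pi.single i 1) {L : Finset ρ}
    (hL : ∀ r, r ∉ L → r ∉ Set.range T → lab r = 0) (ψ : (Fin k → F) → ℂ) :
    IsResidual T lab ψ L (labelState lab ψ) := by
  refine ⟨fun y => if ∀ r, r ∉ L → r ∉ Set.range T → y r = 0 then 1 else 0, fun x x' h => ?_,
    fun y => ?_⟩
  · refine if_congr ⟨fun H r h1 h2 => ?_, fun H r h1 h2 => ?_⟩ rfl rfl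
    · rw [← h r h1 h2, H r h1 h2]
    · rw [h r h1 h2, H r h1 h2]
  · have hx : ∀ x : Fin k → F, (∀ r, y r = lab r ⬝ᵥ x) → x = fun i => y (T i) := by
      intro x hx
      ext i
      rw [hx (T i), hT, single_one_dotProduct]
    have h1 : labelState lab ψ y =
        if ∀ r, y r = lab r ⬝ᵥ (fun i => y (T i)) then ψ (fun i => y (T i)) else 0 := by
      refine Finset.sum_eq_single (fun i => y (T i)) (fun x _ hne => ?_) (by simp)
      exact if_neg fun h => hne (hx x h)
    rw [h1, mul_ite, mul_one, mul_zero, ← ite_and]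
    refine if_congr ⟨fun H => ⟨fun r _ => H r, fun r h1 h2 => ?_⟩, fun ⟨H1, H2⟩ r => ?_⟩ rfl rfl
    · rw [H r, hL r h1 h2, zero_dotProduct]
    · by_cases hr : r ∈ L
      · exact H1 r hr
      · by_cases hr' : r ∈ Set.range T
        · obtain ⟨i, rfl⟩ := hr'
          rw [hT, single_one_dotProduct]
        · rw [H2 r hr hr', hL r hr hr', zero_dotProduct]

theorem IsResidual.exists_factor [Fintype ρ] {T : Fin k ↪ ρ} {lab : ρ → Fin k → F} {ψ : (Fin k → F) → ℂ}
    {Ψ : (ρ → F) → ℂ} (h : IsResidual T lab ψ ∅ Ψ) :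
    ∃ χ : ({r : ρ // r ∉ Set.range T} → F) → ℂ,
      ∀ x, Ψ x = ψ (fun i => x (T i)) * χ (fun r => x r.1) := by
  classical
  obtain ⟨χ, hχ, hΨ⟩ := h
  refine ⟨fun z => χ fun r => if hr : r ∉ Set.range T then z ⟨r, hr⟩ else 0, fun x => ?_⟩
  rw [hΨ, if_pos (by simp)]
  congr 1
  refine hχ _ _ fun r _ hr => ?_
  rw [dif_pos hr]

variable [Fintype F]

/-- The most recent entry of a classical memory. -/
def lastEntry (l : List F) : F := l.getLast?.getD 0

/-- The node `a` sends the last entry of its memory to the owners `t i` of the registers `T i`, which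
apply phases to these registers. -/
noncomputable def correct (E : Type u) (a : V) (t : Fin k → V) (T : Fin k ↪ ρ) (c : Fin k → F)
    (is : List (Fin k)) : List (Instr V E ρ F) :=
  is.flatMap fun i => [sendC a (t i) lastEntry,
    unitary (t i) {T i} fun l => singleUnitary (T i) (phase (-(c i * lastEntry l)))]

theorem finalStates_correct [DecidableEq V] (a : V) (t : Fin k → V) (T : Fin k ↪ ρ) (c : Fin k → F)
    (is : List (Fin k)) (l : List (Instr V E ρ F)) (mem : V → List F) (z : F)
    (hz : lastEntry (mem a) = z) (Ψ : (ρ → F) → ℂ) :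
    ∃ mem', finalStates (correct E a t T c is ++ l) mem Ψ = finalStates l mem' (fun y =>
      AddChar.FiniteField.primitiveChar_to_Complex F (-(is.map fun i => c i * z * y (T i)).sum) *
        Ψ y) := by
  induction is generalizing mem Ψ with
  | nil => exact ⟨mem, by simp [correct]⟩
  | cons i is ih =>
    obtain ⟨mem', h⟩ := ih (Function.update mem (t i) (mem (t i) ++ [lastEntry (mem a)])) (by
      -- If the sender is itself this target, its memory grows, but the appended entry is again z.
      by_cases ha : a = t i
      · subst ha
        simpa [lastEntry] using hz
      · rw [Function.update_of_ne ha, hz]) (fun y =>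
        AddChar.FiniteField.primitiveChar_to_Complex F (-(c i * z * y (T i))) * Ψ y)
    refine ⟨mem', ?_⟩
    simp only [correct, List.flatMap_cons, List.cons_append, List.nil_append, finalStates]
    refine Eq.trans ?_ (h.trans ?_)
    · congr 1
      ext y
      rw [applyOn_phase]
      simp [lastEntry, ← hz]
    · congr 1
      ext y
      rw [← mul_assoc, ← AddChar.map_add_eq_mul, List.map_cons, List.sum_cons, neg_add, add_comm]

theorem legal_correct {N : KPair V E k} {own : ρ → V} {used : Set E} {T : Fin k ↪ ρ}
    (hT : ∀ i, own (T i) = N.target i) (a : V) (c : Fin k → F) (is : List (Fin k))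
    {l : List (Instr V E ρ F)} (hl : Legal N own used l) :
    Legal N own used (correct E a N.target T c is ++ l) := by
  induction is with
  | nil => exact hl
  | cons i is ih =>
    refine ⟨fun r hr => ?_, ih⟩
    rw [Finset.mem_singleton.1 hr, hT]

theorem finalOwner_correct (N : KPair V E k) (own : ρ → V) (a : V) (t : Fin k → V) (T : Fin k ↪ ρ)
    (c : Fin k → F) (is : List (Fin k)) (l : List (Instr V E ρ F)) :
    finalOwner N own (correct E a t T c is ++ l) = finalOwner N own l := by
  induction is with
  | nil => rfl
  | cons i is ih => exact ih

theorem classicalCost_correct (a : V) (t : Fin k → V) (T : Fin k ↪ ρ)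
    (c : Fin k → F) (is : List (Fin k)) (l : List (Instr V E ρ F)) :
    classicalCost (correct E a t T c is ++ l) = is.length + classicalCost l := by
  induction is with
  | nil => simp [correct]
  | cons i is ih =>
    refine (congrArg (· + 1) ih).trans ?_
    rw [List.length_cons]
    omega

/-- The Fourier transform turns the value of `lab r` into a phase, so the outcome `z` leaves no
trace on the other registers but this phase, and the correction cancels it exactly. The measured
register and the normalization go into `χ`. -/
theorem IsResidual.measure [Fintype ρ] {T : Fin k ↪ ρ} {lab : ρ → Fin k → F} {ψ : (Fin k → F) → ℂ}
    {L : Finset ρ} {r : ρ} (hr : r ∉ L) (hrT : r ∉ Set.range T) {Ψ : (ρ → F) → ℂ}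
    (h : IsResidual T lab ψ (insert r L) Ψ) (z : F) :
    IsResidual T lab ψ L (fun y => AddChar.FiniteField.primitiveChar_to_Complex F
      (-((List.finRange k).map fun i => lab r i * z * y (T i)).sum) *
        project r z (applyOn {r} (singleUnitary r (fourier F)).1 Ψ) y) := by
  obtain ⟨χ, hχ, hΨ⟩ := h
  refine ⟨fun y => if y r = z then ((Real.sqrt (Fintype.card F))⁻¹ : ℝ) * χ y else 0,
    fun x x' hx => ?_, fun y => ?_⟩
  · simp only [hx r hr hrT]
    rw [hχ x x' fun s hs => hx s fun hs' => hs (Finset.mem_insert_of_mem hs')]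
  · have hTr : ∀ (a : F) i, Function.update y r a (T i) = y (T i) := fun a i =>
      Function.update_of_ne (fun h => hrT ⟨i, h⟩) _ _
    have hΨr : ∀ a, Ψ (Function.update y r a) =
        if a = lab r ⬝ᵥ (fun i => y (T i)) then
          (if ∀ s ∈ L, y s = lab s ⬝ᵥ (fun i => y (T i)) then ψ (fun i => y (T i)) * χ y else 0)
        else 0 := by
      intro a
      rw [hΨ, ← ite_and]
      simp only [hTr]
      refine if_congr ?_ ?_ rfl
      · rw [Finset.forall_mem_insert, Function.update_self]
        refine and_congr_right fun _ => forall₂_congr fun s hs => ?_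
        rw [Function.update_of_ne (fun h : s = r => hr (h ▸ hs))]
      · rw [hχ (Function.update y r a) y fun s hs _ =>
          Function.update_of_ne (fun h : s = r => hs (h ▸ Finset.mem_insert_self _ _)) _ _]
    have hsum : ((List.finRange k).map fun i => lab r i * z * y (T i)).sum =
        z * lab r ⬝ᵥ (fun i => y (T i)) := by
      rw [← List.ofFn_eq_map, List.sum_ofFn, dotProduct, Finset.mul_sum]
      exact Finset.sum_congr rfl fun i _ => by ring
    by_cases hz : y r = z
    · simp only [project, if_pos hz]
      rw [applyOn_singleUnitary]
      simp only [hΨr, mul_ite, mul_zero, Finset.sum_ite_eq', Finset.mem_univ, if_true]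
      split_ifs
      · rw [hsum, ← hz]
        simp only [fourier, Matrix.of_apply]
        have := AddChar.map_add_eq_mul (AddChar.FiniteField.primitiveChar_to_Complex F)
          (-(y r * lab r ⬝ᵥ (fun i => y (T i)))) (y r * lab r ⬝ᵥ (fun i => y (T i)))
        rw [neg_add_cancel, AddChar.map_zero_eq_one] at this
        linear_combination (-((((Real.sqrt (Fintype.card F))⁻¹ : ℝ) : ℂ) *
          (ψ (fun i => y (T i)) * χ y))) * this
      · rfl
    · simp [project, hz]

/-- Measuring the registers in `L` in the Fourier basis and correcting the phases. -/
theorem exists_measure [DecidableEq V] [Fintype ρ] {N : KPair V E k} {own : ρ → V} {used : Set E} {T : Fin k ↪ ρ}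
    (hT : ∀ i, own (T i) = N.target i) (lab : ρ → Fin k → F) (L : Finset ρ)
    (hL : ∀ r ∈ L, r ∉ Set.range T) :
    ∃ l : List (Instr V E ρ F), Legal N own used l ∧ finalOwner N own l = own ∧
      classicalCost l = L.card * k ∧
      ∀ ψ mem Ψ, IsResidual T lab ψ L Ψ → ∀ Ψ' ∈ finalStates l mem Ψ,
        IsResidual T lab ψ ∅ Ψ' := by
  induction L using Finset.induction_on with
  | empty =>
    refine ⟨[], trivial, rfl, by simp [classicalCost], fun ψ mem Ψ h Ψ' h' => ?_⟩
    rw [Set.mem_singleton_iff.1 h']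
    exact h
  | insert r L hr ih =>
    obtain ⟨l, hlegal, howner, hcost, hstates⟩ := ih fun s hs => hL s (Finset.mem_insert_of_mem hs)
    refine ⟨unitary (own r) {r} (fun _ => singleUnitary r (fourier F)) :: Instr.measure (own r) r ::
      (correct E (own r) N.target T (lab r) (List.finRange k) ++ l), ⟨fun s hs => ?_, rfl, ?_⟩,
      ?_, ?_, fun ψ mem Ψ h Ψ' h' => ?_⟩
    · rw [Finset.mem_singleton.1 hs]
    · exact legal_correct hT _ _ _ hlegal
    · exact (finalOwner_correct ..).trans howner
    · refine (classicalCost_correct ..).trans ?_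
      rw [hcost, List.length_finRange, Finset.card_insert_of_notMem hr]
      ring
    · simp only [finalStates, Set.mem_iUnion] at h'
      obtain ⟨z, h'⟩ := h'
      obtain ⟨mem', hmem'⟩ := finalStates_correct (own r) N.target T (lab r) (List.finRange k) l
        (Function.update mem (own r) (mem (own r) ++ [z])) z (by simp [lastEntry])
        (project r z (applyOn {r} (singleUnitary r (fourier F)).1 Ψ))
      rw [hmem'] at h'
      exact hstates ψ mem' _ (h.measure hr (hL r (Finset.mem_insert_self _ _)) z) Ψ' h'

open Classical in
theorem labelState_wireInput [Fintype E] (ψ : (Fin k → F) → ℂ) (y : Wire E k → F) :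
    labelState (wireInput F) ψ y =
      if ∀ r, r ∉ Set.range inputWire → y r = 0 then ψ (fun i => y (inputWire i)) else 0 := by
  have hin : ∀ i : Fin k, wireInput F (inputWire i : Wire E k) = Pi.single i 1 := fun _ => rfl
  have hother : ∀ r : Wire E k, r ∉ Set.range inputWire → wireInput F r = 0 := by
    rintro (e | i | i) hr
    · rfl
    · exact absurd ⟨i, rfl⟩ hr
    · rfl
  have key : ∀ x : Fin k → F, (∀ r, y r = wireInput F r ⬝ᵥ x) ↔
      (∀ r, r ∉ Set.range inputWire → y r = 0) ∧ x = fun i => y (inputWire i) := by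
    refine fun x => ⟨fun H => ⟨fun r hr => ?_, funext fun i => ?_⟩, fun ⟨H, hx⟩ r => ?_⟩
    · rw [H r, hother r hr, zero_dotProduct]
    · rw [H, hin, single_one_dotProduct]
    · by_cases hr : r ∈ Set.range inputWire
      · obtain ⟨i, rfl⟩ := hr
        rw [hin, single_one_dotProduct, hx]
      · rw [H r hr, hother r hr, zero_dotProduct]
  simp only [labelState, key]
  split_ifs with h
  · exact (Finset.sum_eq_single (fun i => y (inputWire i)) (fun x _ hx => if_neg fun H => hx H.2)
      (by simp)).trans (if_pos ⟨h, rfl⟩)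
  · exact Finset.sum_eq_zero fun x _ => if_neg fun H => h H.1

end Measure

end Instr

/-! ### The protocol and its classical cost -/

open KPair Instr in
theorem mainTheorem3 (k q : ℕ) :
    ∃ C : ℕ, ∀ (F : Type w) [Field F] [Fintype F] [DecidableEq F], Fintype.card F = q →
      ∀ (V E : Type u) [Fintype V] [Fintype E] [DecidableEq V] (N : KPair V E k),
        N.HasLinearSolution F → N.QuantumSolvable F C := by
  classical
  obtain ⟨B, hB⟩ := exists_unabsorbed_bound.{u, w} k q
  -- At most `B` registers are measured, and each outcome is sent to the k targets.
  refine ⟨B * k, fun F _ _ _ hq V E _ _ _ N hN => ?_⟩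
  obtain ⟨rank, M₀, ℓ₀, hflow₀, hout₀, hM₀⟩ := hN.exists_flow
  obtain ⟨M, ℓ, hmin, hout', hsub⟩ := hflow₀.exists_minimal outputWire
  have hM := fun x y h => hM₀ x y (hsub x y h)
  have hout : ∀ i, ℓ (outputWire i) = Pi.single i 1 := fun i => (hout' i).trans (hout₀ i)
  let lab : Wire E k → Fin k → F := fun z => if Absorbed M z then 0 else ℓ z
  let L : Finset (Wire E k) := Finset.univ.filter fun z => lab z ≠ 0 ∧ z ∉ Set.range outputWire
  have hL : L.card ≤ B := by
    refine hB F hq (Wire E k) (wireInput F) inputWire outputWire M ℓ (wireRank rank) hmin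
      (fun x y h => (hM x y h).1) (fun y hy => ?_) L fun y hy => ?_
    · rcases y with e | i | i
      · rfl
      · exact absurd rfl (hy i)
      · rfl
    · obtain ⟨h1, h2⟩ := (Finset.mem_filter.1 hy).2
      have hab : ¬ Absorbed M y := fun h => h1 (if_pos h)
      refine ⟨fun h => h1 ((if_neg hab).trans h), fun i h => h2 ⟨i, h⟩, fun x hx => ?_⟩
      by_contra! hcon
      exact hab ⟨x, hx, hcon⟩
  -- Output wires have the largest rank, so no wire reads them and they are never erased.
  have hlab : ∀ i, lab (outputWire i) = Pi.single i 1 := by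
    intro i
    refine (if_neg ?_).trans (hout i)
    rintro ⟨x, hx, -⟩
    have := (hM _ _ hx).1
    rcases x with e | j | j
    · have h2 := Finset.le_sup (f := rank) (Finset.mem_univ e)
      change Finset.univ.sup rank + 2 < rank e + 1 at this
      omega
    · exact absurd this (Nat.not_lt_zero _)
    · exact lt_irrefl _ this
  obtain ⟨l₁, h₁⟩ := Reach.all (N := N) hmin.1 hM
  obtain ⟨l₂, hlegal, howner, hcost, hstates⟩ := exists_measure (N := N) (own := N.wireHead)
    (used := Set.univ) (T := outputWire) (fun _ => rfl) lab L
    (fun r hr => (Finset.mem_filter.1 hr).2.2)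
  obtain ⟨h₁legal, h₁owner, h₁cost, h₁states⟩ := h₁ l₂
  let P : QuantumProtocol N F := ⟨Wire E k, N.wireTail, inputWire, outputWire, l₁ ++ l₂,
    fun _ => rfl, fun i => by rw [h₁owner, howner]; rfl, h₁legal hlegal⟩
  refine ⟨P, fun ψ Ψ hΨ => ?_, ?_⟩
  · have hinit : P.initialState ψ = labelState (wireInput F) ψ := by
      ext y
      rw [labelState_wireInput]
      exact if_congr Iff.rfl rfl rfl
    rw [hinit] at hΨ
    change Ψ ∈ finalStates (l₁ ++ l₂) _ _ at hΨ
    rw [h₁states] at hΨ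
    refine (hstates ψ _ _ (isResidual_labelState hlab (fun r h1 h2 => ?_) ψ) Ψ hΨ).exists_factor
    by_contra hne
    exact h1 (Finset.mem_filter.2 ⟨Finset.mem_univ _, hne, h2⟩)
  · change classicalCost (l₁ ++ l₂) ≤ _
    rw [h₁cost, hcost]
    exact Nat.mul_le_mul_right k hL
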